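/- Let $R$ be a commutative ring, let $S\subseteq R$ be a multiplicative subset ($1\in S$; zero-divisors are allowed in $S$), and let $R_S$ be the localization of $R$ at $S$. All modules are $R$-modules unless said otherwise. A module $C$ is $S$-weakly cotorsion if $\mathrm{Ext}^1_R(R_S,C)=0$, and a module $G$ is $S$-strongly flat if $\mathrm{Ext}^1_R(G,C)=0$ for every $S$-weakly cotorsion module $C$. A short exact sequence $\eta$ of modules is $S$-pure exact if it is pure exact, $R_S\otimes_R\eta$ is split exact over $R_S$, and $R/sR\otimes_R\eta$ is split exact over $R/sR$ for every $s\in S$. A module $E$ is $S$-pure injective if for every $S$-pure exact sequence $0\to N\to M\to L\to 0$ every homomorphism $N\to E$ extends to $M$. An $S$-pure injective envelope of a module $M$ is a homomorphism $i\colon M\to E$ with $E$ $S$-pure injective such that every homomorphism from $M$ to an $S$-pure injective module factors through $i$, and every endomorphism $\varphi$ of $E$ with $\varphi i=i$ is an automorphism. It is unique up to isomorphism under $M$ when it exists; one then writes $\mathrm{SPE}(M)=E$ and $\mathrm{SPE}(M)/M=E/i(M)$. Assume that the Optimistic Conjecture holds for $(R,S)$, that is: the projective dimension of the $R$-module $R_S$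 is at most $1$, and a flat $R$-module $F$ is $S$-strongly flat if and only if $F_S=R_S\otimes_R F$ is a projective $R_S$-module and, for every $s\in S$, $F/sF=R/sR\otimes_R F$ is a projective $R/sR$-module. Then the following are equivalent: 1. The class of $S$-pure injective modules is closed under extensions: if $0\to N\to M\to L\to 0$ is exact and $N$ and $L$ are $S$-pure injective, then so is $M$. 2. For every module $M$ and every $S$-pure injective envelope $M\to \mathrm{SPE}(M)$, the module $\mathrm{SPE}(M)/M$ is $S$-strongly flat. 3. Every $S$-weakly cotorsion module is $S$-pure injective. -/

import Mathlib

open scoped TensorProduct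
open CategoryTheory

universe u

namespace SPurity

section

variable {R : Type u} [CommRing R]

/-- `0 ⟶ N ⟶ M ⟶ L ⟶ 0` is a short exact sequence of `R`-modules. -/
structure IsShortExact {N M L : Type u} [AddCommGroup N] [Module R N]
    [AddCommGroup M] [Module R M] [AddCommGroup L] [Module R L]
    (f : N →ₗ[R] M) (g : M →ₗ[R] L) : Prop where
  injective : Function.Injective f
  exact : Function.Exact f g
  surjective : Function.Surjective g

/-- Purity of the map `f`: it stays injective after tensoring with any `R`-module. -/
def IsPureMono {N M : Type u} [AddCommGroup N] [Module R N]
    [AddCommGroup M] [Module R M] (f : N →ₗ[R] M) : Prop :=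
  ∀ (X : Type u) [AddCommGroup X] [Module R X], Function.Injective (f.rTensor X)

/-- `A ⊗[R] f` is a split monomorphism of `A`-modules. For a short exact sequence starting with `f`
this says that the sequence obtained by applying `A ⊗[R] -` is split exact over `A` (it is always
right exact). -/
def SplitsOver (A : Type u) [CommRing A] [Algebra R A] {N M : Type u} [AddCommGroup N] [Module R N]
    [AddCommGroup M] [Module R M] (f : N →ₗ[R] M) : Prop :=
  ∃ r : A ⊗[R] M →ₗ[A] A ⊗[R] N, r ∘ₗ f.baseChange A = LinearMap.id

/-- `S`-pure exact sequences: short exact, pure, split after `R_S ⊗ -` over `R_S`, and split after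
`R/sR ⊗ -` over `R/sR` for every `s ∈ S`. -/
structure IsSPureExact (S : Submonoid R) {N M L : Type u} [AddCommGroup N] [Module R N]
    [AddCommGroup M] [Module R M] [AddCommGroup L] [Module R L]
    (f : N →ₗ[R] M) (g : M →ₗ[R] L) : Prop where
  shortExact : IsShortExact f g
  pure : IsPureMono f
  split_localization : SplitsOver (Localization S) f
  split_quotient : ∀ s ∈ S, SplitsOver (R ⧸ Ideal.span {s}) f

/-- `E` is `S`-pure injective: injective with respect to all `S`-pure exact sequences. -/
def IsSPureInjective (S : Submonoid R) (E : Type u) [AddCommGroup E] [Module R E] : Prop :=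
  ∀ (N M L : Type u) [AddCommGroup N] [Module R N] [AddCommGroup M] [Module R M]
    [AddCommGroup L] [Module R L] (f : N →ₗ[R] M) (g : M →ₗ[R] L), IsSPureExact S f g →
    ∀ h : N →ₗ[R] E, ∃ h' : M →ₗ[R] E, h' ∘ₗ f = h

/-- `i : M ⟶ E` is an `S`-pure injective envelope of `M`, i.e. an envelope for the class of
`S`-pure injective modules. -/
structure IsSPureInjectiveEnvelope (S : Submonoid R) {M E : Type u} [AddCommGroup M] [Module R M]
    [AddCommGroup E] [Module R E] (i : M →ₗ[R] E) : Prop where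
  sPureInjective : IsSPureInjective S E
  extend : ∀ (X : Type u) [AddCommGroup X] [Module R X], IsSPureInjective S X →
    ∀ h : M →ₗ[R] X, ∃ h' : E →ₗ[R] X, h' ∘ₗ i = h
  minimal : ∀ φ : E →ₗ[R] E, φ ∘ₗ i = i → Function.Bijective φ

/-- `C` is `S`-weakly cotorsion: `Ext¹_R(R_S, C) = 0`. -/
def IsSWeaklyCotorsion (S : Submonoid R) (C : Type u) [AddCommGroup C] [Module R C] : Prop :=
  Subsingleton (Abelian.Ext.{u} (ModuleCat.of R (Localization S)) (ModuleCat.of R C) 1)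

/-- `G` is `S`-strongly flat: `Ext¹_R(G, C) = 0` for all `S`-weakly cotorsion modules `C`. -/
def IsSStronglyFlat (S : Submonoid R) (G : Type u) [AddCommGroup G] [Module R G] : Prop :=
  ∀ (C : Type u) [AddCommGroup C] [Module R C], IsSWeaklyCotorsion S C →
    Subsingleton (Abelian.Ext.{u} (ModuleCat.of R G) (ModuleCat.of R C) 1)

/-- The Optimistic Conjecture holds for `(R, S)`: the projective dimension of the `R`-module `R_S`
is at most one, and a flat module `F` is `S`-strongly flat if and only if `F_S = R_S ⊗ F` is a
projective `R_S`-module and `F/sF = R/sR ⊗ F` is a projective `R/sR`-module for every `s ∈ S`. -/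
structure OptimisticConjectureHolds (S : Submonoid R) : Prop where
  projectiveDimension_le_one : HasProjectiveDimensionLE (ModuleCat.of R (Localization S)) 1
  stronglyFlat_iff : ∀ (F : Type u) [AddCommGroup F] [Module R F], Module.Flat R F →
    (IsSStronglyFlat S F ↔
      Module.Projective (Localization S) (Localization S ⊗[R] F) ∧
      ∀ s ∈ S, Module.Projective (R ⧸ Ideal.span {s}) ((R ⧸ Ideal.span {s}) ⊗[R] F))

/-- The class of `S`-pure injective modules is closed under extensions. -/
def SPureInjectiveClosedUnderExtensions (S : Submonoid R) : Prop :=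
  ∀ (N M L : Type u) [AddCommGroup N] [Module R N] [AddCommGroup M] [Module R M]
    [AddCommGroup L] [Module R L] (f : N →ₗ[R] M) (g : M →ₗ[R] L), IsShortExact f g →
    IsSPureInjective S N → IsSPureInjective S L → IsSPureInjective S M

end

end SPurity

namespace SPurity

section

variable {R : Type u} [CommRing R]

/-! ### Extending homomorphisms and `Ext¹` -/

/-! 3 → 1 is formal: every short exact sequence ending in `R_S` is `S`-pure, so `S`-pure injective
modules are `S`-weakly cotorsion, and vanishing of `Ext¹(R_S, -)` passes to extensions.

1 → 2 is Wakamatsu's lemma (`IsSPureInjectiveEnvelope.exists_extension`): the cokernel `G` of an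
envelope satisfies `Ext¹(G, X) = 0` for all `S`-pure injective `X`. Character modules as `X` give
flatness of `G`; `R_S`-modules and `R/sR`-modules give projectivity of `G_S` and `G/sG`. The
Optimistic Conjecture then makes `G` strongly flat.

2 → 3 rests on the fact that 2 forces `R → R_S` to be surjective. Otherwise there is an `R`-algebra
`R'`, a domain which `S` localizes to a field, in which some `s ∈ S` is a nonzero nonunit. The
`S`-torsion part `D` of its character module is injective over `R'` and `S`-divisible, and `D` is
the cokernel of an envelope with target `∏ D[t]`. By 2 it is flat; but a flat `S`-divisible module
has no `S`-torsion, a contradiction.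

Once `R → R_S` is onto with kernel `I`, `I` is projective because `R_S` has projective dimension at
most 1. For `C` weakly cotorsion, `Hom(I, C)` is the envelope of `IC`, so 2 yields a section of `C →
Hom(I, C)`. The kernel is an `R_S`-module, hence `C` is a sum of two `S`-pure injective modules. -/

lemma IsShortExact.shortComplex_shortExact {N M L : Type u} [AddCommGroup N] [Module R N]
    [AddCommGroup M] [Module R M] [AddCommGroup L] [Module R L]
    {f : N →ₗ[R] M} {g : M →ₗ[R] L} (h : IsShortExact f g) :
    (ModuleCat.shortComplexOfCompEqZero f g h.exact.linearMap_comp_eq_zero).ShortExact :=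
  ModuleCat.shortComplex_shortExact _ h.exact h.injective h.surjective

lemma IsShortExact.of_ker {M L : Type u} [AddCommGroup M] [Module R M] [AddCommGroup L]
    [Module R L] (g : M →ₗ[R] L) (hg : Function.Surjective g) :
    IsShortExact (LinearMap.ker g).subtype g :=
  ⟨Subtype.val_injective, LinearMap.exact_subtype_ker_map g, hg⟩

lemma IsShortExact.of_range {N M : Type u} [AddCommGroup N] [Module R N]
    [AddCommGroup M] [Module R M] (f : N →ₗ[R] M) (hf : Function.Injective f) :
    IsShortExact f (LinearMap.range f).mkQ :=
  ⟨hf, LinearMap.exact_map_mkQ_range f, Submodule.mkQ_surjective _⟩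

/-- If `Ext¹(L, X) = 0`, every map to `X` extends along monomorphisms with cokernel `L`. -/
lemma IsShortExact.exists_extension {N M L X : Type u} [AddCommGroup N] [Module R N]
    [AddCommGroup M] [Module R M] [AddCommGroup L] [Module R L] [AddCommGroup X] [Module R X]
    {f : N →ₗ[R] M} {g : M →ₗ[R] L} (hfg : IsShortExact f g)
    (hX : Subsingleton (Abelian.Ext.{u} (ModuleCat.of R L) (ModuleCat.of R X) 1))
    (h : N →ₗ[R] X) : ∃ h' : M →ₗ[R] X, h' ∘ₗ f = h := by
  obtain ⟨x₂, hx₂⟩ := Abelian.Ext.contravariant_sequence_exact₁ hfg.shortComplex_shortExact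
    (ModuleCat.of R X) (Abelian.Ext.mk₀ (ModuleCat.ofHom h)) (n₁ := 1) rfl
    (Subsingleton.elim (α := Abelian.Ext.{u} (ModuleCat.of R L) (ModuleCat.of R X) 1) _ _)
  obtain ⟨k, rfl⟩ := (Abelian.Ext.mk₀_bijective _ _).2 x₂
  rw [Abelian.Ext.mk₀_comp_mk₀] at hx₂
  have := (Abelian.Ext.mk₀_bijective _ _).1 hx₂
  exact ⟨k.hom, congrArg ModuleCat.Hom.hom this⟩

/-- If every map to `X` extends along a monomorphism to a projective module with cokernel `L`,
then `Ext¹(L, X) = 0`. -/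
lemma IsShortExact.subsingleton_ext {N M L X : Type u} [AddCommGroup N] [Module R N]
    [AddCommGroup M] [Module R M] [AddCommGroup L] [Module R L] [AddCommGroup X] [Module R X]
    {f : N →ₗ[R] M} {g : M →ₗ[R] L} (hfg : IsShortExact f g) [Module.Projective R M]
    (H : ∀ h : N →ₗ[R] X, ∃ h' : M →ₗ[R] X, h' ∘ₗ f = h) :
    Subsingleton (Abelian.Ext.{u} (ModuleCat.of R L) (ModuleCat.of R X) 1) := by
  refine subsingleton_of_forall_eq 0 fun x => ?_
  have hP : Projective (ModuleCat.of R M) := inferInstance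
  obtain ⟨x₁, rfl⟩ := Abelian.Ext.contravariant_sequence_exact₃ hfg.shortComplex_shortExact
    (ModuleCat.of R X) x (@Abelian.Ext.eq_zero_of_projective _ _ _ _ _ _ _ hP _) (n₀ := 0) rfl
  obtain ⟨k, rfl⟩ := (Abelian.Ext.mk₀_bijective _ _).2 x₁
  obtain ⟨h', hh'⟩ := H k.hom
  have hk : k = ModuleCat.ofHom f ≫ ModuleCat.ofHom h' := by
    ext x
    exact (LinearMap.congr_fun hh' x).symm
  rw [hk, ← Abelian.Ext.mk₀_comp_mk₀]
  exact hfg.shortComplex_shortExact.extClass_comp_assoc (Abelian.Ext.mk₀ (ModuleCat.ofHom h'))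

/-- The free cover of a module. -/
noncomputable abbrev freeCover (G : Type u) [AddCommGroup G] [Module R G] : (G →₀ R) →ₗ[R] G :=
  Finsupp.linearCombination R id

lemma isShortExact_freeCover (G : Type u) [AddCommGroup G] [Module R G] :
    IsShortExact (N := LinearMap.ker (freeCover (R := R) G))
      (LinearMap.ker (freeCover (R := R) G)).subtype (freeCover (R := R) G) :=
  .of_ker _ (Finsupp.linearCombination_surjective _ Function.surjective_id)

/-! ### Purity and splitting after base change -/

lemma SplitsOver.exists_extension {A : Type u} [CommRing A] [Algebra R A] {N M X : Type u}
    [AddCommGroup N] [Module R N] [AddCommGroup M] [Module R M] [AddCommGroup X] [Module R X]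
    [Module A X] [IsScalarTower R A X] {f : N →ₗ[R] M} (hf : SplitsOver A f) (h : N →ₗ[R] X) :
    ∃ h' : M →ₗ[R] X, h' ∘ₗ f = h := by
  obtain ⟨r, hr⟩ := hf
  refine ⟨((h.liftBaseChange A ∘ₗ r).restrictScalars R) ∘ₗ TensorProduct.mk R A M 1, ?_⟩
  ext x
  have := LinearMap.congr_fun hr (1 ⊗ₜ x)
  simp only [LinearMap.comp_apply, LinearMap.baseChange_tmul, LinearMap.id_apply] at this
  simp [this]

/-- The universal map `N → A ⊗ N` is the only test needed: its extension to `M` is adjoint to the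
retraction. -/
lemma splitsOver_of_exists_extension {A : Type u} [CommRing A] [Algebra R A] {N M : Type u}
    [AddCommGroup N] [Module R N] [AddCommGroup M] [Module R M] {f : N →ₗ[R] M}
    (H : ∀ h : N →ₗ[R] A ⊗[R] N, ∃ h' : M →ₗ[R] A ⊗[R] N, h' ∘ₗ f = h) : SplitsOver A f := by
  obtain ⟨h', hh'⟩ := H (TensorProduct.mk R A N 1)
  refine ⟨h'.liftBaseChange A, ?_⟩
  ext x
  simpa using LinearMap.congr_fun hh' x

/-- By adjunction, maps into a character module of `X` are characters of the tensor product with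
`X`, and character duality detects injectivity. -/
lemma isPureMono_iff_exists_extension {N M : Type u} [AddCommGroup N] [Module R N]
    [AddCommGroup M] [Module R M] {f : N →ₗ[R] M} :
    IsPureMono f ↔ ∀ (X : Type u) [AddCommGroup X] [Module R X] (h : N →ₗ[R] CharacterModule X),
      ∃ h' : M →ₗ[R] CharacterModule X, h' ∘ₗ f = h := by
  simp only [IsPureMono, rTensor_injective_iff_lcomp_surjective]
  rfl

lemma IsPureMono.baseChange_injective {N M : Type u} [AddCommGroup N] [Module R N]
    [AddCommGroup M] [Module R M] {f : N →ₗ[R] M} (hf : IsPureMono f) (A : Type u) [CommRing A]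
    [Algebra R A] : Function.Injective (f.baseChange A) := by
  have h := (LinearMap.lTensor_inj_iff_rTensor_inj A f).2 (hf A)
  exact h

lemma splitsOver_of_bijective {A : Type u} [CommRing A] [Algebra R A] {N M : Type u}
    [AddCommGroup N] [Module R N] [AddCommGroup M] [Module R M] {f : N →ₗ[R] M}
    (hf : Function.Bijective (f.baseChange A)) : SplitsOver A f :=
  ⟨(LinearEquiv.ofBijective _ hf).symm, LinearMap.ext fun x =>
    (LinearEquiv.ofBijective _ hf).symm_apply_apply x⟩

lemma baseChange_surjective_of_forall_mem_range {A : Type u} [CommRing A] [Algebra R A]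
    {N M : Type u} [AddCommGroup N] [Module R N] [AddCommGroup M] [Module R M] {f : N →ₗ[R] M}
    (H : ∀ m : M, (1 : A) ⊗ₜ[R] m ∈ LinearMap.range (f.baseChange A)) :
    Function.Surjective (f.baseChange A) := by
  intro z
  rw [← LinearMap.mem_range]
  induction z with
  | zero => exact zero_mem _
  | add x y hx hy => exact add_mem hx hy
  | tmul a m => simpa [TensorProduct.smul_tmul'] using Submodule.smul_mem _ a (H m)

/-- A pure quotient of a flat module is flat. -/
lemma IsShortExact.flat_of_isPureMono {N M L : Type u} [AddCommGroup N] [Module R N]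
    [AddCommGroup M] [Module R M] [AddCommGroup L] [Module R L]
    {f : N →ₗ[R] M} {g : M →ₗ[R] L} (hfg : IsShortExact f g) (hf : IsPureMono f)
    [Module.Flat R M] : Module.Flat R L := by
  rw [Module.Flat.iff_rTensor_injective']
  intro I
  rw [injective_iff_map_eq_zero]
  intro x hx
  obtain ⟨y, rfl⟩ := LinearMap.lTensor_surjective I hfg.surjective x
  have hcomm : g.lTensor R (I.subtype.rTensor M y) = 0 := by
    rw [← hx]
    exact LinearMap.congr_fun
      ((LinearMap.lTensor_comp_rTensor (f := I.subtype) (g := g)).trans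
        (LinearMap.rTensor_comp_lTensor (f := I.subtype) (g := g)).symm) y
  obtain ⟨k, hk⟩ := (lTensor_exact R hfg.exact hfg.surjective _).1 hcomm
  have hI : Function.Exact I.subtype I.mkQ := LinearMap.exact_subtype_mkQ I
  -- Purity enters here: the class of `k` in `(R ⧸ I) ⊗ N` may be tested in `(R ⧸ I) ⊗ M`, where it
  -- comes from `I ⊗ M` and so vanishes.
  have hk0 : I.mkQ.rTensor N k = 0 := by
    apply (LinearMap.lTensor_inj_iff_rTensor_inj (R ⧸ I) f).2 (hf (R ⧸ I))
    rw [map_zero]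
    have h1 : f.lTensor (R ⧸ I) (I.mkQ.rTensor N k) = I.mkQ.rTensor M (f.lTensor R k) :=
      LinearMap.congr_fun
      ((LinearMap.lTensor_comp_rTensor (f := I.mkQ) (g := f)).trans
        (LinearMap.rTensor_comp_lTensor (f := I.mkQ) (g := f)).symm) k
    rw [h1, hk]
    exact (rTensor_exact M hI (Submodule.mkQ_surjective I)).apply_apply_eq_zero y
  obtain ⟨k₀, rfl⟩ := (rTensor_exact N hI (Submodule.mkQ_surjective I) _).1 hk0
  have : y = f.lTensor I k₀ := by
    apply Module.Flat.rTensor_preserves_injective_linearMap (M := M) I.subtype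
      Subtype.val_injective
    rw [← hk]
    exact LinearMap.congr_fun
      ((LinearMap.lTensor_comp_rTensor (f := I.subtype) (g := f)).trans
        (LinearMap.rTensor_comp_lTensor (f := I.subtype) (g := f)).symm) k₀
  rw [this]
  exact (lTensor_exact I hfg.exact hfg.surjective).apply_apply_eq_zero k₀

lemma IsShortExact.isPureMono_of_flat {N M L : Type u} [AddCommGroup N] [Module R N]
    [AddCommGroup M] [Module R M] [AddCommGroup L] [Module R L]
    {f : N →ₗ[R] M} {g : M →ₗ[R] L} (hfg : IsShortExact f g) [Module.Flat R L] :
    IsPureMono f := fun X _ _ =>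
  (LinearMap.lTensor_inj_iff_rTensor_inj X f).1
    (LinearMap.lTensor_injective_of_exact_of_flat g hfg.surjective f hfg.injective hfg.exact X)

lemma IsShortExact.projective_of_splitsOver {N M L : Type u} [AddCommGroup N] [Module R N]
    [AddCommGroup M] [Module R M] [AddCommGroup L] [Module R L]
    {f : N →ₗ[R] M} {g : M →ₗ[R] L} (hfg : IsShortExact f g) [Module.Projective R M]
    {A : Type u} [CommRing A] [Algebra R A] (hf : SplitsOver A f) :
    Module.Projective A (A ⊗[R] L) := by
  have hex : Function.Exact (f.baseChange A) (g.baseChange A) :=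
    lTensor_exact A hfg.exact hfg.surjective
  have hs : Function.Surjective (g.baseChange A) := LinearMap.lTensor_surjective A hfg.surjective
  have hsplit := hex.split_tfae'.out 1 0
  obtain ⟨-, l, hl⟩ := hsplit.1 ⟨hs, hf⟩
  exact Module.Projective.of_split l _ hl

lemma splitsOver_of_projective {N M L : Type u} [AddCommGroup N] [Module R N]
    [AddCommGroup M] [Module R M] [AddCommGroup L] [Module R L]
    {f : N →ₗ[R] M} {g : M →ₗ[R] L} (hfg : IsShortExact f g) (hf : IsPureMono f)
    {A : Type u} [CommRing A] [Algebra R A] [Module.Projective A (A ⊗[R] L)] :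
    SplitsOver A f := by
  have hex : Function.Exact (f.baseChange A) (g.baseChange A) :=
    lTensor_exact A hfg.exact hfg.surjective
  have hs : Function.Surjective (g.baseChange A) := LinearMap.lTensor_surjective A hfg.surjective
  obtain ⟨l, hl⟩ := Module.projective_lifting_property (g.baseChange A) LinearMap.id hs
  have hsplit := hex.split_tfae'.out 0 1
  exact (hsplit.1 ⟨hf.baseChange_injective A, l, hl⟩).2

/-! ### Lifting and descending homomorphisms -/

lemma IsShortExact.exists_lift {N M L X : Type u} [AddCommGroup N] [Module R N]
    [AddCommGroup M] [Module R M] [AddCommGroup L] [Module R L] [AddCommGroup X] [Module R X]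
    {f : N →ₗ[R] M} {g : M →ₗ[R] L} (hfg : IsShortExact f g) (φ : X →ₗ[R] M)
    (hφ : g ∘ₗ φ = 0) : ∃ ψ : X →ₗ[R] N, f ∘ₗ ψ = φ := by
  have hr : ∀ x, φ x ∈ LinearMap.range f := fun x =>
    (hfg.exact (φ x)).1 (LinearMap.congr_fun hφ x)
  refine ⟨(LinearEquiv.ofInjective f hfg.injective).symm.toLinearMap ∘ₗ φ.codRestrict _ hr, ?_⟩
  ext x
  exact congrArg Subtype.val
    ((LinearEquiv.ofInjective f hfg.injective).apply_symm_apply (φ.codRestrict _ hr x))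

lemma exists_desc {M L X : Type u} [AddCommGroup M] [Module R M] [AddCommGroup L] [Module R L]
    [AddCommGroup X] [Module R X] {g : M →ₗ[R] L} (hg : Function.Surjective g) (φ : M →ₗ[R] X)
    (hφ : ∀ x, g x = 0 → φ x = 0) : ∃ ψ : L →ₗ[R] X, ψ ∘ₗ g = φ := by
  refine ⟨(LinearMap.ker g).liftQ φ hφ ∘ₗ (g.quotKerEquivOfSurjective hg).symm.toLinearMap, ?_⟩
  ext x
  have : (g.quotKerEquivOfSurjective hg).symm (g x) = Submodule.Quotient.mk x := by
    rw [LinearEquiv.symm_apply_eq]; rfl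
  rw [LinearMap.comp_apply, LinearMap.comp_apply, LinearEquiv.coe_coe, this]
  rfl

variable {S : Submonoid R}

/-! ### Examples of `S`-pure injective modules -/

lemma isSPureInjective_of_localizationModule (X : Type u) [AddCommGroup X] [Module R X]
    [Module (Localization S) X] [IsScalarTower R (Localization S) X] : IsSPureInjective S X :=
  fun _ _ _ _ _ _ _ _ _ _ _ hfg h => hfg.split_localization.exists_extension h

lemma isSPureInjective_of_quotientModule {s : R} (hs : s ∈ S) (X : Type u) [AddCommGroup X]
    [Module R X] [Module (R ⧸ Ideal.span {s}) X] [IsScalarTower R (R ⧸ Ideal.span {s}) X] :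
    IsSPureInjective S X :=
  fun _ _ _ _ _ _ _ _ _ _ _ hfg h => (hfg.split_quotient s hs).exists_extension h

lemma isSPureInjective_of_isTorsionBy {s : R} (hs : s ∈ S) (X : Type u) [AddCommGroup X]
    [Module R X] (hX : Module.IsTorsionBy R X s) : IsSPureInjective S X := by
  let : Module (R ⧸ Ideal.span {s}) X := hX.module
  have : IsScalarTower R (R ⧸ Ideal.span {s}) X := ⟨fun r a x => by
    obtain ⟨b, rfl⟩ := Ideal.Quotient.mk_surjective a
    exact mul_smul r b x⟩
  exact isSPureInjective_of_quotientModule hs X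

lemma isSPureInjective_characterModule (X : Type u) [AddCommGroup X] [Module R X] :
    IsSPureInjective S (CharacterModule X) :=
  fun _ _ _ _ _ _ _ _ _ _ _ hfg h => isPureMono_iff_exists_extension.1 hfg.pure X h

lemma isSPureInjective_pi {ι : Type u} (X : ι → Type u) [∀ i, AddCommGroup (X i)]
    [∀ i, Module R (X i)] (hX : ∀ i, IsSPureInjective S (X i)) :
    IsSPureInjective S (∀ i, X i) := by
  intro N M L _ _ _ _ _ _ f g hfg h
  choose k hk using fun i => hX i N M L f g hfg (LinearMap.proj i ∘ₗ h)
  refine ⟨LinearMap.pi k, ?_⟩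
  ext x i
  exact LinearMap.congr_fun (hk i) x

lemma IsSPureInjective.of_linearEquiv {X Y : Type u} [AddCommGroup X] [Module R X]
    [AddCommGroup Y] [Module R Y] (hX : IsSPureInjective S X) (e : X ≃ₗ[R] Y) :
    IsSPureInjective S Y := by
  intro N M L _ _ _ _ _ _ f g hfg h
  obtain ⟨k, hk⟩ := hX N M L f g hfg (e.symm.toLinearMap ∘ₗ h)
  refine ⟨e.toLinearMap ∘ₗ k, ?_⟩
  ext x
  simpa using congrArg e (LinearMap.congr_fun hk x)

/-- A module on which all elements of `S` act bijectively is `S`-pure injective. -/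
lemma isSPureInjective_of_isLocalizedModule_id (X : Type u) [AddCommGroup X] [Module R X]
    [IsLocalizedModule S (LinearMap.id : X →ₗ[R] X)] : IsSPureInjective S X :=
  (isSPureInjective_of_localizationModule (Localization S ⊗[R] X)).of_linearEquiv
    (IsLocalizedModule.linearEquiv S (TensorProduct.mk R (Localization S) X 1) LinearMap.id)

/-- A split extension of `S`-pure injective modules is `S`-pure injective. -/
lemma IsSPureInjective.of_section {C E : Type u} [AddCommGroup C] [Module R C]
    [AddCommGroup E] [Module R E] (θ : C →ₗ[R] E) (g : E →ₗ[R] C)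
    (hg : θ ∘ₗ g = LinearMap.id) (hE : IsSPureInjective S E)
    (hK : IsSPureInjective S (LinearMap.ker θ)) : IsSPureInjective S C := by
  intro N M L _ _ _ _ _ _ f p hfp h
  obtain ⟨k, hk⟩ := hE N M L f p hfp (θ ∘ₗ h)
  have hg' : ∀ e, θ (g e) = e := LinearMap.congr_fun hg
  let d : N →ₗ[R] LinearMap.ker θ := (h - g ∘ₗ θ ∘ₗ h).codRestrict _ fun x => by
    simp [hg']
  obtain ⟨l, hl⟩ := hK N M L f p hfp d
  refine ⟨g ∘ₗ k + (LinearMap.ker θ).subtype ∘ₗ l, ?_⟩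
  ext x
  have h1 : k (f x) = θ (h x) := LinearMap.congr_fun hk x
  have h2 : l (f x) = d x := LinearMap.congr_fun hl x
  simp [h1, h2, d]

/-! ### `S`-pure injective, weakly cotorsion and strongly flat modules -/

/-- The element `s` acts as zero on one factor and invertibly on the other. -/
lemma subsingleton_quotient_tensor_localization {s : R} (hs : s ∈ S) :
    Subsingleton ((R ⧸ Ideal.span {s}) ⊗[R] Localization S) := by
  refine subsingleton_of_forall_eq 0 fun z => ?_
  induction z with
  | zero => rfl
  | add x y hx hy => rw [hx, hy, add_zero]
  | tmul a m =>
    have hm : m = s • (Localization.mk 1 ⟨s, hs⟩ * m) := by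
      rw [← smul_mul_assoc, Localization.smul_mk, smul_eq_mul, mul_one,
        Localization.mk_self (⟨s, hs⟩ : S), one_mul]
    have ha : s • a = 0 := by
      obtain ⟨b, rfl⟩ := Ideal.Quotient.mk_surjective a
      exact Ideal.Quotient.eq_zero_iff_mem.2
        (Ideal.mul_mem_right _ _ (Ideal.mem_span_singleton_self s))
    rw [hm, ← TensorProduct.smul_tmul, ha, TensorProduct.zero_tmul]

/-- `R_S` is flat, `R_S ⊗ R_S ≅ R_S` is free over `R_S`, and `R/sR ⊗ R_S = 0`. -/
lemma IsShortExact.isSPureExact_of_localization {N M : Type u} [AddCommGroup N] [Module R N]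
    [AddCommGroup M] [Module R M] {f : N →ₗ[R] M} {g : M →ₗ[R] Localization S}
    (hfg : IsShortExact f g) : IsSPureExact S f g := by
  have : Module.Flat R (Localization S) := IsLocalization.flat _ S
  have hf := hfg.isPureMono_of_flat
  refine ⟨hfg, hf, ?_, fun s hs => ?_⟩
  · have : Module.Projective (Localization S) (Localization S ⊗[R] Localization S) :=
      .of_equiv (IsLocalization.moduleLid S (Localization S) (Localization S)).symm
    exact splitsOver_of_projective hfg hf
  · have := subsingleton_quotient_tensor_localization hs
    have : Module.Free (R ⧸ Ideal.span {s}) ((R ⧸ Ideal.span {s}) ⊗[R] Localization S) :=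
      Module.Free.of_subsingleton _ _
    exact splitsOver_of_projective hfg hf

lemma IsSPureInjective.isSWeaklyCotorsion {X : Type u} [AddCommGroup X] [Module R X]
    (hX : IsSPureInjective S X) : IsSWeaklyCotorsion S X :=
  (isShortExact_freeCover (R := R) (Localization S)).subsingleton_ext fun h =>
    hX _ _ _ _ _ (isShortExact_freeCover (R := R) (Localization S)).isSPureExact_of_localization h

/-- If `Ext¹(G, X) = 0` for all `S`-pure injective `X`, and the Optimistic Conjecture holds, then
`G` is `S`-strongly flat. -/
lemma OptimisticConjectureHolds.isSStronglyFlat (hOC : OptimisticConjectureHolds S)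
    {K P G : Type u} [AddCommGroup K] [Module R K] [AddCommGroup P] [Module R P]
    [AddCommGroup G] [Module R G] [Module.Projective R P] {f : K →ₗ[R] P} {g : P →ₗ[R] G}
    (hfg : IsShortExact f g)
    (H : ∀ (X : Type u) [AddCommGroup X] [Module R X], IsSPureInjective S X →
      ∀ h : K →ₗ[R] X, ∃ h' : P →ₗ[R] X, h' ∘ₗ f = h) : IsSStronglyFlat S G := by
  have hpure : IsPureMono f := isPureMono_iff_exists_extension.2 fun X _ _ h =>
    H _ (isSPureInjective_characterModule X) h
  refine (hOC.stronglyFlat_iff G (hfg.flat_of_isPureMono hpure)).2 ⟨?_, fun s hs => ?_⟩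
  · exact hfg.projective_of_splitsOver
      (splitsOver_of_exists_extension (H _ (isSPureInjective_of_localizationModule _)))
  · exact hfg.projective_of_splitsOver
      (splitsOver_of_exists_extension (H _ (isSPureInjective_of_quotientModule hs _)))

lemma IsSStronglyFlat.flat {G : Type u} [AddCommGroup G] [Module R G]
    (hG : IsSStronglyFlat S G) : Module.Flat R G :=
  (isShortExact_freeCover (R := R) G).flat_of_isPureMono <|
    isPureMono_iff_exists_extension.2 fun X _ _ h =>
      (isShortExact_freeCover (R := R) G).exists_extension
        (hG _ (isSPureInjective_characterModule X).isSWeaklyCotorsion) h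

lemma IsShortExact.isSWeaklyCotorsion {N M L : Type u} [AddCommGroup N] [Module R N]
    [AddCommGroup M] [Module R M] [AddCommGroup L] [Module R L]
    {f : N →ₗ[R] M} {g : M →ₗ[R] L} (hfg : IsShortExact f g)
    (hN : IsSWeaklyCotorsion S N) (hL : IsSWeaklyCotorsion S L) : IsSWeaklyCotorsion S M := by
  refine subsingleton_of_forall_eq 0 fun x => ?_
  obtain ⟨y, rfl⟩ := Abelian.Ext.covariant_sequence_exact₂ (ModuleCat.of R (Localization S))
    hfg.shortComplex_shortExact x (hL.elim _ _)
  rw [show y = 0 from hN.elim _ _, Abelian.Ext.zero_comp]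

/-! ### Wakamatsu's lemma -/

/-- If the class of `S`-pure injective modules is closed under extensions and `i : M → E` is an
`S`-pure injective envelope, then `Ext¹(E / i(M), X) = 0` for every `S`-pure injective `X`. -/
lemma IsSPureInjectiveEnvelope.exists_extension (hS : SPureInjectiveClosedUnderExtensions S)
    {M E K P X : Type u} [AddCommGroup M] [Module R M] [AddCommGroup E] [Module R E]
    [AddCommGroup K] [Module R K] [AddCommGroup P] [Module R P] [AddCommGroup X] [Module R X]
    {i : M →ₗ[R] E} (hi : IsSPureInjectiveEnvelope S i) {f : K →ₗ[R] P}
    {π : P →ₗ[R] E ⧸ LinearMap.range i} (hf : IsShortExact f π) (hX : IsSPureInjective S X)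
    (h : K →ₗ[R] X) : ∃ h' : P →ₗ[R] X, h' ∘ₗ f = h := by
  let q := (LinearMap.range i).mkQ
  have hqi : ∀ m, q (i m) = 0 := fun m => by simp [q]
  -- `F` is the pullback of `E` and `P` over the cokernel of `i`: its projection to `E` has kernel
  -- `K` (via `j`), and its projection to `P` has kernel `M` (via `ι`). Dividing `X × F` by `T` is
  -- the pushout along `h`, an extension of `E` by `X`.
  let F : Submodule R (E × P) :=
    LinearMap.eqLocus (q ∘ₗ LinearMap.fst R E P) (π ∘ₗ LinearMap.snd R E P)
  let j : K →ₗ[R] F := (LinearMap.inr R E P ∘ₗ f).codRestrict F fun k => by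
    simp [F, hf.exact.apply_apply_eq_zero k]
  let T : Submodule R (X × F) := LinearMap.range (h.prod (-j))
  let a : X →ₗ[R] (X × F) ⧸ T := T.mkQ ∘ₗ LinearMap.inl R X F
  let b : F →ₗ[R] (X × F) ⧸ T := T.mkQ ∘ₗ LinearMap.inr R X F
  let fstF : F →ₗ[R] E := LinearMap.fst R E P ∘ₗ F.subtype
  have hbj : ∀ k, b (j k) = a (h k) := fun k => by
    refine ((Submodule.Quotient.eq T).2 ⟨k, ?_⟩).symm
    simp
  let v : (X × F) ⧸ T →ₗ[R] E := T.liftQ (fstF ∘ₗ LinearMap.snd R X F) <| by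
    rintro _ ⟨k, rfl⟩
    exact neg_zero (G := E)
  have hvb : ∀ y, v (b y) = fstF y := fun y => rfl
  have hva : ∀ x, v (a x) = 0 := fun x => map_zero fstF
  have hav : IsShortExact a v := by
    refine ⟨?_, ?_, ?_⟩
    · rw [injective_iff_map_eq_zero]
      intro x hx
      obtain ⟨k, hk⟩ := (Submodule.Quotient.mk_eq_zero T).1 hx
      have h1 : h k = x := congrArg Prod.fst hk
      have h2 : (j k : E × P) = 0 := by
        have : -j k = 0 := congrArg Prod.snd hk
        rw [neg_eq_zero.1 this]; rfl
      have h3 : f k = 0 := congrArg Prod.snd h2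
      rw [← h1, (map_eq_zero_iff f hf.injective).1 h3, map_zero]
    · intro w
      refine ⟨fun hw => ?_, ?_⟩
      · obtain ⟨⟨x, y⟩, rfl⟩ := T.mkQ_surjective w
        have hy1 : (y : E × P).1 = 0 := hw
        have hy2 : π (y : E × P).2 = 0 := by
          have : q (y : E × P).1 = π (y : E × P).2 := y.2
          rw [← this, hy1, map_zero]
        obtain ⟨k, hk⟩ := (hf.exact _).1 hy2
        have hy : y = j k := Subtype.ext (Prod.ext hy1 hk.symm)
        refine ⟨x + h k, ?_⟩
        have : T.mkQ (x, y) = a x + b y := by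
          rw [show ((x, y) : X × F) = (x, 0) + (0, y) by simp, map_add]
          rfl
        rw [this, map_add, hy, hbj]
      · rintro ⟨x, rfl⟩
        exact hva x
    · intro e
      obtain ⟨p, hp⟩ := hf.surjective (q e)
      exact ⟨b ⟨(e, p), hp.symm⟩, rfl⟩
  have hW : IsSPureInjective S ((X × F) ⧸ T) := hS _ _ _ a v hav hX hi.sPureInjective
  let ι : M →ₗ[R] F := (LinearMap.inl R E P ∘ₗ i).codRestrict F fun m => by simp [F, hqi]
  obtain ⟨u, hu⟩ := hi.extend _ hW (b ∘ₗ ι)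
  have hu : ∀ m, u (i m) = b (ι m) := LinearMap.congr_fun hu
  have hvu : ∀ m, v (u (i m)) = i m := fun m => by rw [hu, hvb]; rfl
  -- Minimality of the envelope makes `v ∘ u` invertible, so `u ∘ α⁻¹` is a section of `v`.
  let α := LinearEquiv.ofBijective (v ∘ₗ u) (hi.minimal _ (LinearMap.ext hvu))
  have hα : ∀ m, α.symm (i m) = i m := fun m => by
    rw [LinearEquiv.symm_apply_eq]; exact (hvu m).symm
  have hvα : ∀ e, v (u (α.symm e)) = e := fun e => α.apply_symm_apply e
  -- Subtracting the section gives a map `F → X` which is `h` on `K` and zero on `M`; it therefore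
  -- descends to `P`.
  obtain ⟨ψ, hψ⟩ := hav.exists_lift (b - u ∘ₗ α.symm.toLinearMap ∘ₗ fstF) <| by
    ext y
    simp [hvα, hvb]
  have hψ : ∀ y, a (ψ y) = b y - u (α.symm (fstF y)) := LinearMap.congr_fun hψ
  let sndF : F →ₗ[R] P := LinearMap.snd R E P ∘ₗ F.subtype
  have hsnd : Function.Surjective sndF := fun p => by
    obtain ⟨e, he⟩ := (LinearMap.range i).mkQ_surjective (π p)
    exact ⟨⟨(e, p), he⟩, rfl⟩
  obtain ⟨h', hh'⟩ := exists_desc hsnd ψ <| by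
    intro y hy
    have hy2 : (y : E × P).2 = 0 := hy
    have hy1 : q (y : E × P).1 = 0 := by
      have : q (y : E × P).1 = π (y : E × P).2 := y.2
      rw [this, hy2, map_zero]
    obtain ⟨m, hm⟩ := (Submodule.Quotient.mk_eq_zero _).1 hy1
    have hy : y = ι m := Subtype.ext (Prod.ext hm.symm hy2)
    apply hav.injective
    rw [hψ, hy, map_zero, show fstF (ι m) = i m from rfl, hα, hu, sub_self]
  refine ⟨h', ?_⟩
  ext k
  apply hav.injective
  have h1 : h' (sndF (j k)) = ψ (j k) := LinearMap.congr_fun hh' (j k)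
  have h2 : fstF (j k) = 0 := rfl
  have h3 : (h' ∘ₗ f) k = ψ (j k) := h1
  rw [h3, hψ, h2, map_zero, map_zero, sub_zero, hbj]

lemma SPureInjectiveClosedUnderExtensions.isSStronglyFlat (hOC : OptimisticConjectureHolds S)
    (hS : SPureInjectiveClosedUnderExtensions S) {M E : Type u} [AddCommGroup M] [Module R M]
    [AddCommGroup E] [Module R E] {i : M →ₗ[R] E} (hi : IsSPureInjectiveEnvelope S i) :
    IsSStronglyFlat S (E ⧸ LinearMap.range i) :=
  hOC.isSStronglyFlat (isShortExact_freeCover (R := R) (E ⧸ LinearMap.range i)) fun _ _ _ hX h =>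
    hi.exists_extension hS (isShortExact_freeCover (R := R) (E ⧸ LinearMap.range i)) hX h

lemma sPureInjectiveClosedUnderExtensions_of_isSWeaklyCotorsion
    (H : ∀ (C : Type u) [AddCommGroup C] [Module R C],
      IsSWeaklyCotorsion S C → IsSPureInjective S C) : SPureInjectiveClosedUnderExtensions S :=
  fun _ _ _ _ _ _ _ _ _ _ _ hfg hN hL =>
    H _ (hfg.isSWeaklyCotorsion hN.isSWeaklyCotorsion hL.isSWeaklyCotorsion)

/-! ### The case of a surjective localization map -/

/-- The kernel of the localization map `R → R_S`. -/
abbrev localizationKer (S : Submonoid R) : Ideal R := RingHom.ker (algebraMap R (Localization S))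

lemma mem_localizationKer {a : R} : a ∈ localizationKer S ↔ ∃ s ∈ S, s * a = 0 := by
  rw [RingHom.mem_ker, IsLocalization.map_eq_zero_iff S]
  simp

lemma isShortExact_localizationKer (hS : Function.Surjective (algebraMap R (Localization S))) :
    IsShortExact (N := localizationKer S) (localizationKer S).subtype
      (Algebra.linearMap R (Localization S)) :=
  ⟨Subtype.val_injective, LinearMap.exact_subtype_ker_map (Algebra.linearMap R (Localization S)),
    hS⟩

/-- Dimension shifting along `0 → I → R → R_S → 0`. -/
lemma projective_localizationKer (hS : Function.Surjective (algebraMap R (Localization S)))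
    (hpd : HasProjectiveDimensionLE (ModuleCat.of R (Localization S)) 1) :
    Module.Projective R (localizationKer S) := by
  have h : HasProjectiveDimensionLT (ModuleCat.of R (localizationKer S)) 1 :=
    (isShortExact_localizationKer hS).shortComplex_shortExact.hasProjectiveDimensionLT_X₁ 1
      (projective_iff_hasProjectiveDimensionLT_one.1
        (inferInstanceAs (Projective (ModuleCat.of R R)))) hpd
  exact (IsProjective.iff_projective _).2 (projective_iff_hasProjectiveDimensionLT_one.2 h)

/-- Take `r` to be a lift of `1/s`. -/
lemma exists_mul_eq_one_sub (hS : Function.Surjective (algebraMap R (Localization S))) {s : R}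
    (hs : s ∈ S) : ∃ r, ∃ b ∈ localizationKer S, r * s = 1 - b := by
  obtain ⟨r, hr⟩ := hS (Localization.mk 1 ⟨s, hs⟩)
  refine ⟨r, 1 - r * s, ?_, by ring⟩
  rw [RingHom.mem_ker, map_sub, map_mul, hr, map_one, ← Localization.mk_one_eq_algebraMap,
    Localization.mk_mul, sub_eq_zero]
  simp

/-- Elements killed by some element of `S` are fixed by some element of the kernel of `R → R_S`. -/
lemma exists_smul_eq_self (hS : Function.Surjective (algebraMap R (Localization S))) {s : R}
    (hs : s ∈ S) : ∃ b ∈ localizationKer S, ∀ (M : Type u) [AddCommGroup M] [Module R M] (m : M),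
      s • m = 0 → b • m = m := by
  obtain ⟨r, b, hb, hrb⟩ := exists_mul_eq_one_sub hS hs
  refine ⟨b, hb, fun M _ _ m hm => ?_⟩
  have : (1 - b) • m = 0 := by rw [← hrb, mul_smul, hm, smul_zero]
  rw [sub_smul, one_smul, sub_eq_zero] at this
  exact this.symm

lemma exists_mul_eq_self (hS : Function.Surjective (algebraMap R (Localization S)))
    (a : localizationKer S) : ∃ b ∈ localizationKer S, b • a = a := by
  obtain ⟨s, hs, hsa⟩ := mem_localizationKer.1 a.2
  obtain ⟨b, hb, H⟩ := exists_smul_eq_self hS hs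
  exact ⟨b, hb, H _ _ (Subtype.ext hsa)⟩

/-- `Hom(I, C)` is `S`-pure injective, where `I` is the kernel of `R → R_S`, if `I` is
projective. -/
lemma isSPureInjective_hom_localizationKer [Module.Projective R (localizationKer S)]
    (C : Type u) [AddCommGroup C] [Module R C] :
    IsSPureInjective S (localizationKer S →ₗ[R] C) := by
  intro N M L _ _ _ _ _ _ f g hfg h
  have hext : ∀ a : localizationKer S, ∃ k : M →ₗ[R] C, ∀ x, k (f x) = h x a := by
    intro a
    obtain ⟨s, hs, hsa⟩ := mem_localizationKer.1 a.2
    have hsa : s • a = 0 := Subtype.ext hsa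
    -- Since `s • a = 0`, evaluation at `a` lands in the `s`-torsion of `C`, an `R/sR`-module.
    let d : N →ₗ[R] Submodule.torsionBy R C s :=
      (LinearMap.applyₗ a ∘ₗ h).codRestrict _ fun x => by
        simp [Submodule.mem_torsionBy_iff, ← map_smul, hsa]
    obtain ⟨k, hk⟩ := isSPureInjective_of_isTorsionBy hs (Submodule.torsionBy R C s)
      (Submodule.torsionBy_isTorsionBy s) N M L f g hfg d
    exact ⟨(Submodule.torsionBy R C s).subtype ∘ₗ k, fun x =>
      congrArg Subtype.val (LinearMap.congr_fun hk x)⟩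
  choose k hk using hext
  -- The chosen extensions `k a` need not be linear in `a`; a section of the free cover of `I` makes
  -- them so.
  obtain ⟨σ, hσ⟩ := Module.projective_def'.1 ‹Module.Projective R (localizationKer S)›
  refine ⟨(Finsupp.linearCombination R k ∘ₗ σ).flip, ?_⟩
  have key : ∀ (x : N) (c : localizationKer S →₀ R),
      Finsupp.linearCombination R k c (f x) = h x (Finsupp.linearCombination R id c) := by
    intro x c
    induction c using Finsupp.induction_linear with
    | zero => simp
    | add c d hc hd => rw [map_add, map_add, map_add, LinearMap.add_apply, hc, hd]
    | single a r => simp [hk]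
  ext x a
  rw [LinearMap.comp_apply, LinearMap.flip_apply, LinearMap.comp_apply, key]
  exact congrArg (h x) (LinearMap.congr_fun hσ a)

/-- The canonical map `C → Hom(I, C)`, where `I` is the kernel of `R → R_S`. -/
noncomputable abbrev toHomLocalizationKer (S : Submonoid R) (C : Type u) [AddCommGroup C]
    [Module R C] : C →ₗ[R] localizationKer S →ₗ[R] C :=
  ((LinearMap.lsmul R C).comp (localizationKer S).subtype).flip

/-- A map `I → C` extends to `R`, and is then multiplication by the image of `1`. -/
lemma IsSWeaklyCotorsion.toHomLocalizationKer_surjective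
    (hS : Function.Surjective (algebraMap R (Localization S)))
    {C : Type u} [AddCommGroup C] [Module R C] (hC : IsSWeaklyCotorsion S C) :
    Function.Surjective (toHomLocalizationKer S C) := by
  intro φ
  obtain ⟨k, hk⟩ := (isShortExact_localizationKer hS).exists_extension hC φ
  refine ⟨k 1, ?_⟩
  ext a
  rw [← hk]
  simp [← map_smul]

/-- If `R → R_S` is surjective, then `S` acts bijectively on the kernel of `C → Hom(I, C)`. -/
lemma isSPureInjective_ker_toHomLocalizationKer
    (hS : Function.Surjective (algebraMap R (Localization S)))
    (C : Type u) [AddCommGroup C] [Module R C] :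
    IsSPureInjective S (LinearMap.ker (toHomLocalizationKer S C)) := by
  have hI : ∀ b ∈ localizationKer S, ∀ c : LinearMap.ker (toHomLocalizationKer S C),
      b • c = 0 := fun b hb c =>
    Subtype.ext (LinearMap.congr_fun (LinearMap.mem_ker.1 c.2) ⟨b, hb⟩)
  have hu : ∀ s : S, ∃ r : R, ∀ c : LinearMap.ker (toHomLocalizationKer S C),
      r • s • c = c := fun s => by
    obtain ⟨r, b, hb, hrb⟩ := exists_mul_eq_one_sub hS s.2
    refine ⟨r, fun c => ?_⟩
    rw [Submonoid.smul_def, smul_smul, hrb, sub_smul, hI b hb, one_smul, sub_zero]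
  have : IsLocalizedModule S
      (LinearMap.id (R := R) (M := LinearMap.ker (toHomLocalizationKer S C))) := by
    refine ⟨fun s => (Module.End.isUnit_iff _).2 ?_, fun y => ⟨(y, 1), one_smul _ _⟩,
      fun {x y} hxy => ⟨1, congrArg _ hxy⟩⟩
    obtain ⟨r, hr⟩ := hu s
    refine ⟨fun x y hxy => ?_, fun y => ⟨r • y, ?_⟩⟩
    · rw [← hr x, ← hr y]
      exact congrArg (r • ·) hxy
    · exact (smul_comm (s : R) r y).trans (hr y)
  exact isSPureInjective_of_isLocalizedModule_id _

/-! ### `S`-torsion modules and `S`-pure monomorphisms -/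

lemma subsingleton_localization_tensor {M : Type u} [AddCommGroup M] [Module R M]
    (hM : ∀ m : M, ∃ s ∈ S, s • m = 0) : Subsingleton (Localization S ⊗[R] M) := by
  refine subsingleton_of_forall_eq 0 fun z => ?_
  induction z with
  | zero => rfl
  | add x y hx hy => rw [hx, hy, add_zero]
  | tmul a m =>
    obtain ⟨s, hs, hm⟩ := hM m
    have ha : a = s • (Localization.mk 1 ⟨s, hs⟩ * a) := by
      rw [← smul_mul_assoc, Localization.smul_mk, smul_eq_mul, mul_one,
        Localization.mk_self (⟨s, hs⟩ : S), one_mul]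
    rw [ha, TensorProduct.smul_tmul, hm, TensorProduct.tmul_zero]

lemma exists_smul_tensor_eq_zero {M X : Type u} [AddCommGroup M] [Module R M]
    [AddCommGroup X] [Module R X] (hM : ∀ m : M, ∃ s ∈ S, s • m = 0) (z : M ⊗[R] X) :
    ∃ s ∈ S, s • z = 0 := by
  induction z with
  | zero => exact ⟨1, S.one_mem, smul_zero _⟩
  | add x y hx hy =>
    obtain ⟨s, hs, hsx⟩ := hx
    obtain ⟨t, ht, hty⟩ := hy
    refine ⟨t * s, S.mul_mem ht hs, ?_⟩
    rw [smul_add, mul_smul, hsx, smul_zero, zero_add, mul_comm, mul_smul, hty, smul_zero]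
  | tmul m x =>
    obtain ⟨s, hs, hm⟩ := hM m
    exact ⟨s, hs, by rw [TensorProduct.smul_tmul', hm, TensorProduct.zero_tmul]⟩

/-- If `R → R_S` is surjective with kernel `I`, a map from an `S`-torsion module which is split up
to multiplication by each element of `I` is the start of an `S`-pure exact sequence. -/
lemma IsShortExact.isSPureExact_of_localizationKer
    (hS : Function.Surjective (algebraMap R (Localization S)))
    {M E L : Type u} [AddCommGroup M] [Module R M] [AddCommGroup E] [Module R E]
    [AddCommGroup L] [Module R L] {i : M →ₗ[R] E} {p : E →ₗ[R] L} (hip : IsShortExact i p)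
    (hM : ∀ m : M, ∃ s ∈ S, s • m = 0)
    (hi : ∀ b ∈ localizationKer S, ∃ ρ : E →ₗ[R] M, ρ ∘ₗ i = b • LinearMap.id) :
    IsSPureExact S i p := by
  refine ⟨hip, fun X _ _ => ?_, ?_, fun s hs => ?_⟩
  · rw [injective_iff_map_eq_zero]
    intro z hz
    obtain ⟨s, hs, hsz⟩ := exists_smul_tensor_eq_zero hM z
    obtain ⟨b, hb, hbz⟩ := exists_smul_eq_self hS hs
    obtain ⟨ρ, hρ⟩ := hi b hb
    rw [← hbz _ z hsz]
    have h1 : ρ.rTensor X (i.rTensor X z) = b • z := by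
      rw [← LinearMap.comp_apply, ← LinearMap.rTensor_comp, hρ, LinearMap.rTensor_smul]
      simp
    rw [← h1, hz, map_zero]
  · have := subsingleton_localization_tensor hM
    exact ⟨0, LinearMap.ext fun x => Subsingleton.elim _ _⟩
  · obtain ⟨r, b, hb, hrb⟩ := exists_mul_eq_one_sub hS hs
    obtain ⟨ρ, hρ⟩ := hi b hb
    -- Modulo `s` the element `b` becomes `1`, so `ρ` becomes a genuine retraction.
    have hb1 : (algebraMap R (R ⧸ Ideal.span {s})) b = 1 := by
      rw [← sub_eq_zero, ← map_one (algebraMap R (R ⧸ Ideal.span {s})), ← map_sub]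
      refine Ideal.Quotient.eq_zero_iff_mem.2 (Ideal.mem_span_singleton.2 ⟨-r, ?_⟩)
      rw [mul_neg, mul_comm, hrb]
      ring
    refine ⟨ρ.baseChange _, LinearMap.ext fun z => ?_⟩
    induction z with
    | zero => rw [map_zero, map_zero]
    | add x y hx hy => rw [map_add, map_add, hx, hy]
    | tmul a m =>
      have hm : ρ (i m) = b • m := LinearMap.congr_fun hρ m
      rw [LinearMap.comp_apply, LinearMap.baseChange_tmul, LinearMap.baseChange_tmul, hm,
        ← TensorProduct.smul_tmul, Algebra.smul_def, hb1, one_mul, LinearMap.id_apply]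

/-- Suppose that `R → R_S` is surjective with projective kernel `I`. If cokernels of `S`-pure
injective envelopes are `S`-strongly flat, then `S`-weakly cotorsion modules are `S`-pure
injective. -/
lemma IsSWeaklyCotorsion.isSPureInjective_of_surjective
    (hS : Function.Surjective (algebraMap R (Localization S)))
    [Module.Projective R (localizationKer S)]
    (H : ∀ (M E : Type u) [AddCommGroup M] [Module R M] [AddCommGroup E] [Module R E]
        (i : M →ₗ[R] E), IsSPureInjectiveEnvelope S i → IsSStronglyFlat S (E ⧸ LinearMap.range i))
    {C : Type u} [AddCommGroup C] [Module R C] (hC : IsSWeaklyCotorsion S C) :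
    IsSPureInjective S C := by
  let I := localizationKer S
  let θ := toHomLocalizationKer S C
  have hθ : Function.Surjective θ := hC.toHomLocalizationKer_surjective hS
  have hE : IsSPureInjective S (I →ₗ[R] C) := isSPureInjective_hom_localizationKer C
  let M : Submodule R C := I • ⊤
  have hM : ∀ m : M, ∃ s ∈ S, s • m = 0 := by
    rintro ⟨m, hm⟩
    suffices ∃ s ∈ S, s • m = 0 by
      obtain ⟨s, hs, h⟩ := this
      exact ⟨s, hs, Subtype.ext h⟩
    refine Submodule.smul_induction_on hm ?_ ?_
    · intro a ha c _
      obtain ⟨s, hs, hsa⟩ := mem_localizationKer.1 ha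
      exact ⟨s, hs, by rw [smul_smul, hsa, zero_smul]⟩
    · rintro x y ⟨s, hs, hsx⟩ ⟨t, ht, hty⟩
      refine ⟨t * s, S.mul_mem ht hs, ?_⟩
      rw [smul_add, mul_smul, hsx, smul_zero, zero_add, mul_comm, mul_smul, hty, smul_zero]
  have heval : ∀ (e : I →ₗ[R] C) (b : I), e b ∈ M := fun e b => by
    obtain ⟨c, hc, hcb⟩ := exists_mul_eq_self hS b
    rw [← hcb, map_smul]
    exact Submodule.smul_mem_smul hc Submodule.mem_top
  let i : M →ₗ[R] (I →ₗ[R] C) := θ ∘ₗ M.subtype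
  have hii : Function.Injective i := by
    rw [injective_iff_map_eq_zero]
    intro m hm
    obtain ⟨s, hs, hsm⟩ := hM m
    obtain ⟨b, hb, hbm⟩ := exists_smul_eq_self hS hs
    rw [← hbm _ m hsm]
    exact Subtype.ext (LinearMap.congr_fun hm ⟨b, hb⟩)
  have hpure : IsSPureExact S i (LinearMap.range i).mkQ := by
    -- Evaluation at `b` maps `Hom(I, C)` to `M = IC`, and composed with `i` it is multiplication by
    -- `b`.
    refine (IsShortExact.of_range i hii).isSPureExact_of_localizationKer hS hM fun b hb => ?_
    exact ⟨(LinearMap.applyₗ (⟨b, hb⟩ : I)).codRestrict M fun e => heval e _, rfl⟩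
  -- The value of `e` at `x` is that of `b • e` whenever `b • x = x`, and `b • e` is the image under
  -- `i` of `e b`. So `i(M)` determines every endomorphism.
  have hmin : ∀ φ : (I →ₗ[R] C) →ₗ[R] (I →ₗ[R] C), φ ∘ₗ i = i → φ = LinearMap.id := by
    intro φ hφ
    ext e x
    obtain ⟨b, hb, hbx⟩ := exists_mul_eq_self hS x
    have h1 : b • e = i ⟨e ⟨b, hb⟩, heval e _⟩ := by
      ext y
      change b • e y = (y : R) • e ⟨b, hb⟩
      rw [← map_smul, ← map_smul]
      exact congrArg e (Subtype.ext (mul_comm _ _))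
    have h2 : φ (b • e) = b • e := by
      rw [h1]
      exact LinearMap.congr_fun hφ _
    have h3 : ∀ e' : I →ₗ[R] C, e' x = (b • e') x := fun e' => by
      rw [LinearMap.smul_apply, ← map_smul, hbx]
    rw [LinearMap.id_apply, h3 (φ e), ← map_smul, h2, ← h3]
  have henv : IsSPureInjectiveEnvelope S i :=
    ⟨hE, fun X _ _ hX h => hX _ _ _ i _ hpure h, fun φ hφ => by
      rw [hmin φ hφ]; exact Function.bijective_id⟩
  -- Strong flatness of the cokernel extends the inclusion `IC → C` along `i`. Then `θ ∘ g` fixes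
  -- `i`, so it is the identity by `hmin`.
  obtain ⟨g, hg⟩ := (IsShortExact.of_range i hii).exists_extension (H _ _ i henv C hC) M.subtype
  refine .of_section θ g (hmin _ ?_) hE (isSPureInjective_ker_toHomLocalizationKer hS C)
  rw [LinearMap.comp_assoc, hg]

/-! ### Divisible torsion modules as cokernels of envelopes -/

lemma exists_smul_eq_zero_of_fg {D : Type u} [AddCommGroup D] [Module R D]
    (htors : ∀ d : D, ∃ s ∈ S, s • d = 0) (Q : Submodule R D) (hQ : Q.FG) :
    ∃ s ∈ S, ∀ d ∈ Q, s • d = 0 := by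
  induction Q, hQ using Submodule.fg_induction with
  | singleton d =>
    obtain ⟨s, hs, hd⟩ := htors d
    refine ⟨s, hs, fun x hx => ?_⟩
    obtain ⟨r, rfl⟩ := Submodule.mem_span_singleton.1 hx
    rw [smul_comm, hd, smul_zero]
  | sup N₁ N₂ _ _ h₁ h₂ =>
    obtain ⟨s, hs, h₁⟩ := h₁
    obtain ⟨t, ht, h₂⟩ := h₂
    refine ⟨t * s, S.mul_mem ht hs, fun x hx => ?_⟩
    obtain ⟨y, hy, z, hz, rfl⟩ := Submodule.mem_sup.1 hx
    rw [smul_add, mul_smul, h₁ y hy, smul_zero, zero_add, mul_comm, mul_smul, h₂ z hz, smul_zero]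

/-- A submodule inclusion is pure if it is split on finitely generated submodules. -/
lemma isPureMono_subtype_of_fg {E : Type u} [AddCommGroup E] [Module R E] (M : Submodule R E)
    (H : ∀ Q : Submodule R E, Q.FG → ∃ ρ : Q →ₗ[R] M, ∀ q : Q, ∀ h : (q : E) ∈ M,
      ρ q = ⟨q, h⟩) : IsPureMono M.subtype := by
  intro X _ _
  rw [injective_iff_map_eq_zero]
  intro z hz
  obtain ⟨P, hP, t, rfl⟩ := TensorProduct.exists_of_fg z
  have hP' : (P.map M.subtype).FG := hP.map _
  have h1 : (P.map M.subtype).subtype.rTensor X ((M.subtype.submoduleMap P).rTensor X t) = 0 := by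
    rw [← hz, ← LinearMap.comp_apply, ← LinearMap.comp_apply, ← LinearMap.rTensor_comp,
      ← LinearMap.rTensor_comp]
    rfl
  obtain ⟨Q, hPQ, hQ, h2⟩ := TensorProduct.eq_zero_of_fg_of_subtype_eq_zero hP' h1
  obtain ⟨ρ, hρ⟩ := H Q hQ
  have h3 : ρ ∘ₗ Submodule.inclusion hPQ ∘ₗ M.subtype.submoduleMap P = P.subtype := by
    ext p
    exact congrArg Subtype.val (hρ (Submodule.inclusion hPQ (M.subtype.submoduleMap P p)) p.1.2)
  rw [← h3, LinearMap.rTensor_comp, LinearMap.rTensor_comp, LinearMap.comp_apply,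
    LinearMap.comp_apply, h2, map_zero]

open Classical in
/-- Let `D` be an `S`-divisible `S`-torsion module such that the map from the direct sum of
the submodules `D[t]`, `t ∈ S`, to `D` extends to the product. Then the kernel of the extended map
has the product as its `S`-pure injective envelope. -/
lemma isSPureInjectiveEnvelope_ker {D : Type u} [AddCommGroup D] [Module R D]
    (hdiv : ∀ s ∈ S, ∀ d : D, ∃ d', s • d' = d) (htors : ∀ d : D, ∃ s ∈ S, s • d = 0)
    (f : (∀ t : S, Submodule.torsionBy R D (t : R)) →ₗ[R] D)
    (hf : ∀ t x, f (Pi.single t x) = (x : D)) :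
    IsSPureInjectiveEnvelope S (LinearMap.ker f).subtype := by
  have hsurj : Function.Surjective f := fun d => by
    obtain ⟨s, hs, hd⟩ := htors d
    exact ⟨_, hf ⟨s, hs⟩ ⟨d, hd⟩⟩
  have hE : IsSPureInjective S (∀ t : S, Submodule.torsionBy R D (t : R)) :=
    isSPureInjective_pi _ fun t =>
      isSPureInjective_of_isTorsionBy t.2 _ (Submodule.torsionBy_isTorsionBy _)
  have hpure : IsPureMono (LinearMap.ker f).subtype := by
    refine isPureMono_subtype_of_fg _ fun Q hQ => ?_
    obtain ⟨s, hs, hsQ⟩ := exists_smul_eq_zero_of_fg htors (Q.map f) (hQ.map f)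
    let τ : Q →ₗ[R] Submodule.torsionBy R D s :=
      (f ∘ₗ Q.subtype).codRestrict _ fun q => hsQ _ (Submodule.mem_map_of_mem q.2)
    -- One `s` kills `f(Q)`, so placing `f q` in coordinate `s` and subtracting corrects `q` into
    -- the kernel of `f`.
    refine ⟨(Q.subtype - LinearMap.single R (fun t : S => Submodule.torsionBy R D (t : R))
      ⟨s, hs⟩ ∘ₗ τ).codRestrict _ fun q => ?_, fun q hq => Subtype.ext ?_⟩
    · rw [LinearMap.mem_ker, LinearMap.sub_apply, map_sub, sub_eq_zero]
      exact (hf ⟨s, hs⟩ (τ q)).symm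
    · have hτ : τ q = 0 := Subtype.ext hq
      change (q : ∀ t : S, Submodule.torsionBy R D (t : R)) -
        Pi.single (M := fun t : S => Submodule.torsionBy R D (t : R)) (⟨s, hs⟩ : S) (τ q) = q
      rw [hτ, Pi.single_zero, sub_zero]
  have hdec : ∀ s ∈ S, ∀ e : (∀ t : S, Submodule.torsionBy R D (t : R)),
      ∃ m : LinearMap.ker f, ∃ e', e = m + s • e' := fun s hs e => by
    obtain ⟨d', hd'⟩ := hdiv s hs (f e)
    obtain ⟨e', rfl⟩ := hsurj d'
    exact ⟨⟨e - s • e', by rw [LinearMap.mem_ker, map_sub, map_smul, hd', sub_self]⟩, e', by simp⟩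
  -- The inclusion becomes bijective over `R_S` because `D` is torsion, and over `R/sR` because `D`
  -- is divisible.
  have hSpure : IsSPureExact S (LinearMap.ker f).subtype f := by
    refine ⟨.of_ker f hsurj, hpure, ?_, fun s hs => ?_⟩
    · refine splitsOver_of_bijective ⟨hpure.baseChange_injective _,
        baseChange_surjective_of_forall_mem_range fun e => ?_⟩
      obtain ⟨s, hs, hse⟩ := htors (f e)
      refine ⟨Localization.mk 1 ⟨s, hs⟩ ⊗ₜ ⟨s • e, by rw [LinearMap.mem_ker, map_smul, hse]⟩, ?_⟩
      rw [LinearMap.baseChange_tmul, Submodule.subtype_apply, ← TensorProduct.smul_tmul,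
        Localization.smul_mk, smul_eq_mul, mul_one, Localization.mk_self (⟨s, hs⟩ : S)]
    · refine splitsOver_of_bijective ⟨hpure.baseChange_injective _,
        baseChange_surjective_of_forall_mem_range fun e => ?_⟩
      obtain ⟨m, e', rfl⟩ := hdec s hs e
      refine ⟨1 ⊗ₜ m, ?_⟩
      have h0 : s • (1 : R ⧸ Ideal.span {s}) = 0 := by
        rw [Algebra.smul_def, mul_one]
        exact Ideal.Quotient.eq_zero_iff_mem.2 (Ideal.mem_span_singleton_self s)
      rw [LinearMap.baseChange_tmul, Submodule.subtype_apply, TensorProduct.tmul_add,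
        ← TensorProduct.smul_tmul, h0, TensorProduct.zero_tmul, add_zero]
  refine ⟨hE, fun X _ _ hX h => hX _ _ _ _ _ hSpure h, fun φ hφ => ?_⟩
  -- Coordinate `t` is killed by `t`, while every `e` lies in `ker f` modulo `t`; so fixing `ker f`
  -- fixes every coordinate.
  have hid : φ = LinearMap.id := by
    refine LinearMap.ext fun e => funext fun t => ?_
    obtain ⟨m, e', rfl⟩ := hdec t t.2 e
    have hm : φ m = m := LinearMap.congr_fun hφ m
    have ht : ∀ e : (∀ t : S, Submodule.torsionBy R D (t : R)), ((t : R) • e) t = 0 := fun e =>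
      Submodule.torsionBy_isTorsionBy (R := R) (M := D) (t : R) (x := e t)
    rw [map_add, map_smul, hm, LinearMap.id_apply, Pi.add_apply, Pi.add_apply, ht, ht]
  rw [hid]
  exact Function.bijective_id

/-- The equational criterion writes `d = ∑ aⱼ yⱼ` with `s aⱼ = 0`, and each `yⱼ` is divisible by
`s`. -/
lemma eq_zero_of_flat_of_divisible {D : Type u} [AddCommGroup D] [Module R D] [Module.Flat R D]
    {s : R} (hdiv : ∀ d : D, ∃ d', s • d' = d) {d : D} (hd : s • d = 0) : d = 0 := by
  obtain ⟨k, a, y, hx, ha⟩ := Module.Flat.isTrivialRelation_of_sum_smul_eq_zero (R := R)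
    (ι := Unit) (f := fun _ => s) (x := fun _ => d) (by simpa using hd)
  refine (hx ()).trans (Finset.sum_eq_zero fun j _ => ?_)
  obtain ⟨z, hz⟩ := hdiv (y j)
  have haj : s * a () j = 0 := by simpa using ha j
  rw [← hz, smul_smul, mul_comm, haj, zero_smul]

/-! ### Torsion injective modules -/

section Torsion

variable (S) (R' : Type u) [CommRing R'] [Algebra R R']

instance : IsScalarTower R R' (CharacterModule R') :=
  ⟨fun r a χ => by ext x; exact congrArg χ (smul_mul_assoc r a x |>.trans (mul_smul_comm r a x).symm)⟩

/-- The `S`-torsion part of the character module of an algebra. -/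
def torsionCharacter : Submodule R' (CharacterModule R') where
  carrier := {χ | ∃ s ∈ S, s • χ = 0}
  zero_mem' := ⟨1, S.one_mem, smul_zero _⟩
  add_mem' := by
    rintro x y ⟨s, hs, hx⟩ ⟨t, ht, hy⟩
    refine ⟨t * s, S.mul_mem ht hs, ?_⟩
    rw [smul_add, mul_smul, hx, smul_zero, zero_add, mul_comm, mul_smul, hy, smul_zero]
  smul_mem' := by
    rintro a x ⟨s, hs, hx⟩
    exact ⟨s, hs, by rw [smul_comm, hx, smul_zero]⟩

variable {S R'}

/-- Baer's criterion: a map from a nonzero ideal extends to the injective module of all characters.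
The ideal contains the image of some `t ∈ S`, so `t • k 1` is torsion, and hence `k 1` is too. -/
lemma torsionCharacter_injective
    (hS : ∀ x : R', x ≠ 0 → ∃ y, ∃ t ∈ S, y * x = algebraMap R R' t) :
    Module.Injective R' (torsionCharacter S R') := by
  refine Module.Baer.injective fun J h => ?_
  by_cases hJ : J = ⊥
  · subst hJ
    refine ⟨0, fun x hx => ?_⟩
    have : (⟨x, hx⟩ : (⊥ : Ideal R')) = 0 := Subsingleton.elim _ _
    rw [this, map_zero, LinearMap.zero_apply]
  · obtain ⟨x, hxJ, hx⟩ := Submodule.exists_mem_ne_zero_of_ne_bot hJ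
    obtain ⟨y, t, ht, hyx⟩ := hS x hx
    have hinj : Module.Injective R' (CharacterModule R') :=
      Module.Flat.iff_characterModule_injective.1 inferInstance
    obtain ⟨k, hk⟩ := Module.Baer.of_injective hinj J ((torsionCharacter S R').subtype ∘ₗ h)
    have htJ : algebraMap R R' t ∈ J := hyx ▸ J.mul_mem_left y hxJ
    obtain ⟨s, hs, hst⟩ := (h ⟨_, htJ⟩).2
    have h1 : k 1 ∈ torsionCharacter S R' := by
      refine ⟨s * t, S.mul_mem hs ht, ?_⟩
      rw [mul_smul, ← hst]
      congr 1
      refine Eq.trans ?_ (hk _ htJ)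
      rw [Algebra.algebraMap_eq_smul_one, LinearMap.map_smul_of_tower]
    refine ⟨k.codRestrict _ fun r => ?_, fun z hz => Subtype.ext (hk z hz)⟩
    rw [← mul_one r, ← smul_eq_mul, map_smul]
    exact Submodule.smul_mem _ r h1

lemma exists_smul_eq_torsionCharacter (hreg : ∀ s ∈ S, ∀ x : R', s • x = 0 → x = 0) {s : R}
    (hs : s ∈ S) (d : torsionCharacter S R') : ∃ d', s • d' = d := by
  have hinj : Function.Injective (LinearMap.lsmul R R' s) := by
    rw [injective_iff_map_eq_zero]
    exact hreg s hs
  obtain ⟨χ, hχ⟩ := CharacterModule.dual_surjective_of_injective _ hinj d.1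
  have hχ : s • χ = d.1 := hχ
  obtain ⟨t, ht, htd⟩ := d.2
  exact ⟨⟨χ, t * s, S.mul_mem ht hs, by rw [mul_smul, hχ, htd]⟩, Subtype.ext hχ⟩

/-- Pull back a character of `R'/sR'` that is nonzero at `1`. -/
lemma exists_torsionCharacter_ne_zero {s : R} (hs : s ∈ S) (hu : ¬ IsUnit (algebraMap R R' s)) :
    ∃ d : torsionCharacter S R', d ≠ 0 ∧ s • d = 0 := by
  have h1 : (Submodule.Quotient.mk 1 : R' ⧸ Ideal.span {algebraMap R R' s}) ≠ 0 := by
    rw [Ne, Submodule.Quotient.mk_eq_zero]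
    intro h
    exact hu (Ideal.span_singleton_eq_top.1 ((Ideal.eq_top_iff_one _).2 h))
  obtain ⟨c, hc⟩ := CharacterModule.exists_character_apply_ne_zero_of_ne_zero h1
  let χ : CharacterModule R' := CharacterModule.dual (Ideal.span {algebraMap R R' s}).mkQ c
  have hχ : s • χ = 0 := by
    ext x
    change c (Submodule.Quotient.mk (s • x)) = 0
    have : (Submodule.Quotient.mk (s • x) : R' ⧸ Ideal.span {algebraMap R R' s}) = 0 := by
      rw [Submodule.Quotient.mk_eq_zero, Algebra.smul_def]
      exact Ideal.mul_mem_right _ _ (Ideal.mem_span_singleton_self _)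
    rw [this, map_zero]
  refine ⟨⟨χ, s, hs, hχ⟩, fun h => hc ?_, Subtype.ext hχ⟩
  exact DFunLike.congr_fun (congrArg Subtype.val h) (1 : R')

-- Injectivity over `R'` extends the sum map from the direct sum to the product; `c` only identifies
-- torsion over `R` with torsion over `R'`.
open Classical in
lemma exists_extension_torsionCharacter
    (hS : ∀ x : R', x ≠ 0 → ∃ y, ∃ t ∈ S, y * x = algebraMap R R' t) :
    ∃ f : (∀ t : S, Submodule.torsionBy R (torsionCharacter S R') (t : R)) →ₗ[R]
        torsionCharacter S R', ∀ t x, f (Pi.single t x) = (x : torsionCharacter S R') := by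
  let D := torsionCharacter S R'
  let X : S → Type u := fun t => Submodule.torsionBy R' D (algebraMap R R' t)
  have := torsionCharacter_injective hS
  obtain ⟨f, hf⟩ := Module.Injective.extension_property R' D (DirectSum S X) (∀ t, X t)
    (DirectSum.coeFnLinearMap (M := X) R') DFunLike.coe_injective
    (DirectSum.toModule R' S D fun t => (Submodule.torsionBy R' D (algebraMap R R' t)).subtype)
  let c : ∀ t : S, Submodule.torsionBy R D (t : R) →ₗ[R] X t := fun t =>
    (Submodule.torsionBy R D (t : R)).subtype.codRestrict
      ((Submodule.torsionBy R' D (algebraMap R R' t)).restrictScalars R) fun x => by simp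
  refine ⟨f.restrictScalars R ∘ₗ LinearMap.pi fun t => c t ∘ₗ LinearMap.proj t, fun t x => ?_⟩
  have h1 : LinearMap.pi (fun t => c t ∘ₗ LinearMap.proj t) (Pi.single t x) =
      DirectSum.coeFnLinearMap (M := X) R' (DirectSum.lof R' S X t (c t x)) := by
    funext u
    change c u ((Pi.single t x : ∀ t : S, Submodule.torsionBy R D (t : R)) u) =
      DirectSum.lof R' S X t (c t x) u
    rcases eq_or_ne u t with rfl | hut
    · rw [Pi.single_eq_same, DirectSum.lof_apply]
    · rw [Pi.single_eq_of_ne hut, map_zero]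
      exact (DirectSum.of_eq_of_ne t u _ hut).symm
  rw [LinearMap.comp_apply, h1]
  refine (LinearMap.congr_fun hf _).trans ?_
  rw [DirectSum.toModule_lof]
  rfl

end Torsion

/-! ### Surjectivity of the localization map -/

/-- If cokernels of `S`-pure injective envelopes are `S`-strongly flat, then the elements of `S`
are invertible in every algebra on which they act injectively and all of whose nonzero ideals
contain the image of an element of `S`. -/
lemma isUnit_algebraMap_of_isSStronglyFlat
    (H : ∀ (M E : Type u) [AddCommGroup M] [Module R M] [AddCommGroup E] [Module R E]
        (i : M →ₗ[R] E), IsSPureInjectiveEnvelope S i → IsSStronglyFlat S (E ⧸ LinearMap.range i))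
    {R' : Type u} [CommRing R'] [Algebra R R'] (hreg : ∀ s ∈ S, ∀ x : R', s • x = 0 → x = 0)
    (hS : ∀ x : R', x ≠ 0 → ∃ y, ∃ t ∈ S, y * x = algebraMap R R' t) {s : R} (hs : s ∈ S) :
    IsUnit (algebraMap R R' s) := by
  classical
  by_contra hu
  obtain ⟨d, hd, hsd⟩ := exists_torsionCharacter_ne_zero hs hu
  obtain ⟨f, hf⟩ := exists_extension_torsionCharacter hS
  have hdiv : ∀ s ∈ S, ∀ d : torsionCharacter S R', ∃ d', s • d' = d := fun s hs d =>
    exists_smul_eq_torsionCharacter hreg hs d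
  have htors : ∀ d : torsionCharacter S R', ∃ s ∈ S, s • d = 0 := fun d => by
    obtain ⟨s, hs, h⟩ := d.2
    exact ⟨s, hs, Subtype.ext h⟩
  have hflat := (H _ _ _ (isSPureInjectiveEnvelope_ker hdiv htors f
    fun t x => by convert hf t x)).flat
  rw [Submodule.range_subtype] at hflat
  have hsurj : Function.Surjective f := fun d => by
    obtain ⟨s, hs, hd⟩ := htors d
    exact ⟨_, hf ⟨s, hs⟩ ⟨d, hd⟩⟩
  have : Module.Flat R (torsionCharacter S R') :=
    .of_linearEquiv (f.quotKerEquivOfSurjective hsurj).symm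
  exact hd (eq_zero_of_flat_of_divisible (R := R) (D := torsionCharacter S R') (hdiv s hs) hsd)

lemma algebraMap_localization_surjective_of_isSStronglyFlat
    (H : ∀ (M E : Type u) [AddCommGroup M] [Module R M] [AddCommGroup E] [Module R E]
        (i : M →ₗ[R] E), IsSPureInjectiveEnvelope S i → IsSStronglyFlat S (E ⧸ LinearMap.range i)) :
    Function.Surjective (algebraMap R (Localization S)) := by
  suffices h : ∀ s ∈ S, ∃ r, algebraMap R (Localization S) (s * r) = 1 by
    intro z
    obtain ⟨⟨a, s⟩, rfl⟩ := IsLocalization.mk'_surjective S z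
    obtain ⟨r, hr⟩ := h s s.2
    refine ⟨a * r, ?_⟩
    rw [eq_comm, IsLocalization.mk'_eq_iff_eq_mul, ← map_mul, mul_assoc, mul_comm r, map_mul, hr,
      mul_one]
  intro s hs
  by_contra! hr
  have hne : localizationKer S ⊔ Ideal.span {s} ≠ ⊤ := by
    rw [Ne, Ideal.eq_top_iff_one]
    intro h1
    obtain ⟨a, ha, b, hb, hab⟩ := Submodule.mem_sup.1 h1
    obtain ⟨r, rfl⟩ := Ideal.mem_span_singleton.1 hb
    refine hr r ?_
    rw [← map_one (algebraMap R (Localization S)), ← hab, map_add, RingHom.mem_ker.1 ha, zero_add]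
  obtain ⟨m, hm, hle⟩ := Ideal.exists_le_maximal _ hne
  -- `s` lies in `m`, and since `m` contains the kernel of `R → R_S`, no element of `S` dies in `A`.
  -- The required algebra is the image of `A` in a residue field of `T⁻¹A`.
  let A := Localization.AtPrime m
  let T : Submonoid A := S.map (algebraMap R A)
  have hT : (0 : A) ∉ T := by
    rintro ⟨t, ht, ht0⟩
    obtain ⟨⟨a, ha⟩, hat⟩ := (IsLocalization.map_eq_zero_iff m.primeCompl A t).1 ht0
    exact ha (hle (Ideal.mem_sup_left (mem_localizationKer.2 ⟨t, ht, by rw [mul_comm]; exact hat⟩)))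
  have : Nontrivial (Localization T) := by
    refine (subsingleton_or_nontrivial _).resolve_left fun h => hT ?_
    exact IsLocalization.subsingleton_iff.1 h
  obtain ⟨n, hn⟩ := Ideal.exists_maximal (Localization T)
  let _ : Field (Localization T ⧸ n) := Ideal.Quotient.field n
  let φ : A →+* Localization T ⧸ n := (Ideal.Quotient.mk n).comp (algebraMap A (Localization T))
  have hφ : ∀ t ∈ S, φ (algebraMap R A t) ≠ 0 := fun t ht =>
    (((IsLocalization.map_units (Localization T) (⟨_, t, ht, rfl⟩ : T)).map
      (Ideal.Quotient.mk n))).ne_zero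
  have hu := isUnit_algebraMap_of_isSStronglyFlat H (R' := A ⧸ RingHom.ker φ) ?_ ?_ hs
  · obtain ⟨y, hy⟩ := hu.exists_right_inv
    obtain ⟨a, rfl⟩ := Ideal.Quotient.mk_surjective y
    have h0 : φ (1 - algebraMap R A s * a) = 0 := by
      rw [← RingHom.mem_ker, ← Ideal.Quotient.eq_zero_iff_mem, map_sub, map_one, sub_eq_zero,
        map_mul]
      exact hy.symm
    have hsm : s ∉ m.primeCompl := fun h =>
      h (hle (Ideal.mem_sup_right (Ideal.mem_span_singleton_self s)))
    -- An inverse `a` of `s` modulo `ker φ` would put this unit of the local ring `A` into `ker φ`.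
    have h1 : IsUnit (1 - algebraMap R A s * a) :=
      IsLocalRing.isUnit_one_sub_self_of_mem_nonunits _ fun h =>
        hsm ((IsLocalization.AtPrime.isUnit_to_map_iff A m s).1 (isUnit_of_mul_isUnit_left h))
    exact (h1.map φ).ne_zero h0
  · intro t ht x hx
    obtain ⟨a, rfl⟩ := Ideal.Quotient.mk_surjective x
    have h0 : φ (algebraMap R A t * a) = 0 := by
      rw [← RingHom.mem_ker, ← Ideal.Quotient.eq_zero_iff_mem, map_mul, ← hx, Algebra.smul_def]
      rfl
    rw [map_mul] at h0
    exact Ideal.Quotient.eq_zero_iff_mem.2 ((mul_eq_zero.1 h0).resolve_left (hφ t ht))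
  · intro x hx
    obtain ⟨a, rfl⟩ := Ideal.Quotient.mk_surjective x
    have ha : φ a ≠ 0 := fun h => hx (Ideal.Quotient.eq_zero_iff_mem.2 h)
    -- The inverse of `φ a` comes from a fraction `b/t` in `T⁻¹A`, so `b * a` equals `t` in the
    -- image of `A`.
    obtain ⟨z, hz⟩ := Ideal.Quotient.mk_surjective (φ a)⁻¹
    obtain ⟨⟨b, ⟨_, t, ht, rfl⟩⟩, rfl⟩ := IsLocalization.mk'_surjective T z
    have hb : φ b = (φ a)⁻¹ * φ (algebraMap R A t) := by
      rw [← hz]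
      change Ideal.Quotient.mk n (algebraMap A (Localization T) b) = _
      rw [← IsLocalization.mk'_spec (Localization T) b (⟨_, t, ht, rfl⟩ : T), map_mul]
      rfl
    refine ⟨Ideal.Quotient.mk _ b, t, ht, ?_⟩
    rw [← map_mul]
    refine Ideal.Quotient.eq.2 ?_
    rw [RingHom.mem_ker, map_sub, map_mul, hb, mul_right_comm, inv_mul_cancel₀ ha, one_mul,
      sub_eq_zero]

end

end SPurity

theorem mainTheorem4 {R : Type u} [CommRing R] (S : Submonoid R)
    (hOC : SPurity.OptimisticConjectureHolds S) :
    List.TFAE [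
      SPurity.SPureInjectiveClosedUnderExtensions S,
      ∀ (M E : Type u) [AddCommGroup M] [Module R M] [AddCommGroup E] [Module R E]
        (i : M →ₗ[R] E), SPurity.IsSPureInjectiveEnvelope S i →
        SPurity.IsSStronglyFlat S (E ⧸ LinearMap.range i),
      ∀ (C : Type u) [AddCommGroup C] [Module R C],
        SPurity.IsSWeaklyCotorsion S C → SPurity.IsSPureInjective S C] := by
  tfae_have 1 → 2 := fun h _ _ _ _ _ _ _ hi => h.isSStronglyFlat hOC hi
  tfae_have 2 → 3 := fun H _ _ _ hC => by
    have hS := SPurity.algebraMap_localization_surjective_of_isSStronglyFlat H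
    have := SPurity.projective_localizationKer hS hOC.projectiveDimension_le_one
    exact hC.isSPureInjective_of_surjective hS H
  tfae_have 3 → 1 := SPurity.sPureInjectiveClosedUnderExtensions_of_isSWeaklyCotorsion
  tfae_finish
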